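/- All graphs are simple and connected (finite or infinite). A graph is regarded as a metric graph: every edge is identified with the interval $[0,1]$, the points are the vertices together with the interior points of the edges, and the distance between two points is the infimum of the lengths of the paths joining them. A metric space $X$ is called (Gromov) hyperbolic if there is a $\delta\ge 0$ such that in every geodesic triangle of $X$ each point of any side is at distance at most $\delta$ from the union of the other two sides. The lexicographic product $G_1\circ G_2$ of graphs $G_1$, $G_2$ has vertex set $V(G_1)\times V(G_2)$, with $(u_1,v_1)$ and $(u_2,v_2)$ adjacent if and only if either $u_1$ and $u_2$ are adjacent in $G_1$, or $u_1=u_2$ and $v_1$ and $v_2$ are adjacent in $G_2$. Theorem. Let $G_1$ and $G_2$ be connected simple graphs. (1) If $G_1$ has at least two vertices, then $G_1\circ G_2$ is hyperbolic if and only if $G_1$ is hyperbolic. (2) If $G_1$ has exactly one vertex, then $G_1\circ G_2$ is isomorphic to $G_2$; hence $G_1\circ G_2$ is hyperbolic if and only if $G_2$ is hyperbolic. -/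

import Mathlib

/-- The lexicographic product `G₁ ∘ G₂` of two simple graphs: the vertex set is `V₁ × V₂`, and
`(u₁, v₁)`, `(u₂, v₂)` are adjacent if `u₁, u₂` are adjacent in `G₁`, or `u₁ = u₂` and `v₁, v₂`
are adjacent in `G₂`. -/
def SimpleGraph.lexProduct {V₁ V₂ : Type*} (G₁ : SimpleGraph V₁) (G₂ : SimpleGraph V₂) :
    SimpleGraph (V₁ × V₂) where
  Adj x y := G₁.Adj x.1 y.1 ∨ (x.1 = y.1 ∧ G₂.Adj x.2 y.2)
  symm := ⟨fun _ _ h => h.imp (fun h => h.symm) (fun h => ⟨h.1.symm, h.2.symm⟩)⟩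
  loopless := ⟨fun _ h => h.elim (fun h => h.ne rfl) (fun h => h.2.ne rfl)⟩

/-- The lexicographic product of two connected graphs is connected. -/
theorem SimpleGraph.Connected.lexProduct {V₁ V₂ : Type*} {G₁ : SimpleGraph V₁}
    {G₂ : SimpleGraph V₂} (h₁ : G₁.Connected) (h₂ : G₂.Connected) :
    (G₁.lexProduct G₂).Connected := by
  have key₂ : ∀ (u : V₁) (v v' : V₂), (G₁.lexProduct G₂).Reachable (u, v) (u, v') := by
    intro u v v'
    exact (h₂.preconnected v v').map
      (⟨fun v => (u, v), fun h => Or.inr ⟨rfl, h⟩⟩ : G₂ →g G₁.lexProduct G₂)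
  have key₁ : ∀ (v : V₂) (u u' : V₁), (G₁.lexProduct G₂).Reachable (u, v) (u', v) := by
    intro v u u'
    exact (h₁.preconnected u u').map
      (⟨fun u => (u, v), fun h => Or.inl h⟩ : G₁ →g G₁.lexProduct G₂)
  have := h₁.nonempty
  have := h₂.nonempty
  exact SimpleGraph.Connected.mk fun x y =>
    (key₁ x.2 x.1 y.1).trans (key₂ y.1 x.2 y.2)

/-- The points of the graph `G` viewed as a metric graph, in barycentric coordinates. A vertex `u`
is the indicator function of `u`. A point of an edge `[u, v]` is a function `p ≥ 0` that vanishes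
off `{u, v}` with `p u + p v = 1`; under the identification of `[u, v]` with the interval `[0, 1]`
it is the point at distance `1 - p u` from `u` and `1 - p v` from `v`. -/
@[ext]
structure MetricGraph {V : Type*} (G : SimpleGraph V) where
  /-- The barycentric coordinates. -/
  coord : V → ℝ
  nonneg : ∀ w, 0 ≤ coord w
  mem_vertex_or_edge :
    (∃ u, coord u = 1 ∧ ∀ w, w ≠ u → coord w = 0) ∨
    (∃ u v, G.Adj u v ∧ coord u + coord v = 1 ∧ ∀ w, w ≠ u → w ≠ v → coord w = 0)

namespace MetricGraph

variable {V : Type*} {G : SimpleGraph V}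

/-- The lengths of the paths from `p` to `q` in the metric graph. A path either runs inside one
edge `[u, v]` that contains both points, or it goes along an edge from `p` to a vertex `u`, follows
a walk of `G` (with edges of length one) from `u` to `u'`, and goes along an edge from `u'` to
`q`. -/
def pathLengths (p q : MetricGraph G) : Set ℝ :=
  {L | (∃ u v, G.Adj u v ∧ p.coord u + p.coord v = 1 ∧ q.coord u + q.coord v = 1 ∧
          L = |p.coord u - q.coord u|) ∨
       (∃ (u u' : V) (w : G.Walk u u'), 0 < p.coord u ∧ 0 < q.coord u' ∧
          L = (1 - p.coord u) + w.length + (1 - q.coord u'))}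

/-- The distance on the metric graph induced by taking shortest paths. -/
noncomputable instance : Dist (MetricGraph G) := ⟨fun p q => sInf (pathLengths p q)⟩

theorem dist_def (p q : MetricGraph G) : dist p q = sInf (pathLengths p q) := rfl

theorem coord_le_one (p : MetricGraph G) (w : V) : p.coord w ≤ 1 := by
  rcases p.mem_vertex_or_edge with ⟨u, h1, h0⟩ | ⟨u, v, huv, h1, h0⟩
  · by_cases h : w = u
    · rw [h, h1]
    · rw [h0 w h]; exact zero_le_one
  · have hu := p.nonneg u
    have hv := p.nonneg v
    by_cases h : w = u
    · subst h; linarith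
    · by_cases h' : w = v
      · subst h'; linarith
      · rw [h0 w h h']; exact zero_le_one

theorem exists_coord_pos (p : MetricGraph G) : ∃ u, 0 < p.coord u := by
  by_contra! h
  rcases p.mem_vertex_or_edge with ⟨u, h1, -⟩ | ⟨u, v, -, h1, -⟩
  · linarith [h u]
  · linarith [h u, h v]

theorem add_eq_one_of_pos (p : MetricGraph G) {a b : V} (hab : a ≠ b) (ha : 0 < p.coord a)
    (hb : 0 < p.coord b) : G.Adj a b ∧ p.coord a + p.coord b = 1 := by
  rcases p.mem_vertex_or_edge with ⟨u, h1, h0⟩ | ⟨u, v, huv, h1, h0⟩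
  · have h2 : a = u := by by_contra h; linarith [h0 a h]
    have h3 : b = u := by by_contra h; linarith [h0 b h]
    exact absurd (h2.trans h3.symm) hab
  · have h2 : a = u ∨ a = v := by by_contra! h; linarith [h0 a h.1 h.2]
    have h3 : b = u ∨ b = v := by by_contra! h; linarith [h0 b h.1 h.2]
    rcases h2 with rfl | rfl <;> rcases h3 with rfl | rfl
    · exact absurd rfl hab
    · exact ⟨huv, h1⟩
    · exact ⟨huv.symm, by linarith⟩
    · exact absurd rfl hab

theorem add_le_one (p : MetricGraph G) {a b : V} (hab : a ≠ b) :
    p.coord a + p.coord b ≤ 1 := by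
  rcases (p.nonneg a).eq_or_lt with ha | ha
  · linarith [p.coord_le_one b]
  · rcases (p.nonneg b).eq_or_lt with hb | hb
    · linarith [p.coord_le_one a]
    · exact (p.add_eq_one_of_pos hab ha hb).2.le

theorem eq_zero_of_add_eq_one (p : MetricGraph G) {a b c : V} (hab : a ≠ b) (hca : c ≠ a)
    (hcb : c ≠ b) (h : p.coord a + p.coord b = 1) : p.coord c = 0 := by
  by_contra hc
  have hc : 0 < p.coord c := lt_of_le_of_ne (p.nonneg c) (Ne.symm hc)
  rcases (p.nonneg a).eq_or_lt with ha | ha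
  · have := p.add_le_one hcb; linarith
  · rcases (p.nonneg b).eq_or_lt with hb | hb
    · have := p.add_le_one hca; linarith
    · have h1 := (p.add_eq_one_of_pos hca hc ha).2
      have h2 := (p.add_eq_one_of_pos hcb hc hb).2
      rcases p.mem_vertex_or_edge with ⟨u, h1', h0⟩ | ⟨u, v, huv, h1', h0⟩
      · have e1 : a = u := by by_contra h; linarith [h0 a h]
        have e2 : b = u := by by_contra h; linarith [h0 b h]
        exact hab (e1.trans e2.symm)
      · have e1 : a = u ∨ a = v := by by_contra! h; linarith [h0 a h.1 h.2]
        have e2 : b = u ∨ b = v := by by_contra! h; linarith [h0 b h.1 h.2]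
        have e3 : c = u ∨ c = v := by by_contra! h; linarith [h0 c h.1 h.2]
        grind

theorem pathLengths_nonneg {p q : MetricGraph G} {L : ℝ} (hL : L ∈ pathLengths p q) : 0 ≤ L := by
  rcases hL with ⟨u, v, -, -, -, rfl⟩ | ⟨u, u', w, -, -, rfl⟩
  · exact abs_nonneg _
  · have h1 := p.coord_le_one u
    have h2 := q.coord_le_one u'
    have h3 : (0 : ℝ) ≤ w.length := Nat.cast_nonneg _
    linarith

theorem bddBelow_pathLengths (p q : MetricGraph G) : BddBelow (pathLengths p q) :=
  ⟨0, fun _ h => pathLengths_nonneg h⟩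

theorem pathLengths_nonempty (hG : G.Connected) (p q : MetricGraph G) :
    (pathLengths p q).Nonempty := by
  obtain ⟨u, hu⟩ := p.exists_coord_pos
  obtain ⟨v, hv⟩ := q.exists_coord_pos
  obtain ⟨w⟩ := hG.preconnected u v
  exact ⟨_, Or.inr ⟨u, v, w, hu, hv, rfl⟩⟩

theorem pathLengths_symm {p q : MetricGraph G} {L : ℝ} (hL : L ∈ pathLengths p q) :
    L ∈ pathLengths q p := by
  rcases hL with ⟨u, v, h, hp, hq, rfl⟩ | ⟨u, u', w, hu, hu', rfl⟩
  · exact Or.inl ⟨u, v, h, hq, hp, abs_sub_comm _ _⟩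
  · exact Or.inr ⟨u', u, w.reverse, hu', hu, by rw [SimpleGraph.Walk.length_reverse]; ring⟩

theorem zero_mem_pathLengths (p : MetricGraph G) : (0 : ℝ) ∈ pathLengths p p := by
  rcases p.mem_vertex_or_edge with ⟨u, h1, -⟩ | ⟨u, v, huv, h1, -⟩
  · exact Or.inr ⟨u, u, SimpleGraph.Walk.nil, by rw [h1]; exact one_pos,
      by rw [h1]; exact one_pos, by simp [h1]⟩
  · exact Or.inl ⟨u, v, huv, h1, h1, by simp⟩

theorem abs_coord_sub_le {p q : MetricGraph G} {L : ℝ} (hL : L ∈ pathLengths p q) (c : V) :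
    |p.coord c - q.coord c| ≤ L := by
  rcases hL with ⟨u, v, h, hp, hq, rfl⟩ | ⟨u, u', w, hu, hu', rfl⟩
  · by_cases h1 : c = u
    · rw [h1]
    · by_cases h2 : c = v
      · rw [h2, show p.coord v - q.coord v = -(p.coord u - q.coord u) by linarith, abs_neg]
      · rw [p.eq_zero_of_add_eq_one h.ne h1 h2 hp, q.eq_zero_of_add_eq_one h.ne h1 h2 hq]
        simp
  · have hp0 := p.nonneg c
    have hq0 := q.nonneg c
    have hp1 := p.coord_le_one c
    have hq1 := q.coord_le_one c
    have hpu := p.coord_le_one u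
    have hqu := q.coord_le_one u'
    rcases w with _ | ⟨hadj, w⟩
    · have h0 : ((SimpleGraph.Walk.nil : G.Walk u u).length : ℝ) = 0 := by simp
      rw [h0, abs_le]
      by_cases h1 : c = u
      · subst h1; constructor <;> linarith
      · have e1 := p.add_le_one h1
        have e2 := q.add_le_one h1
        constructor <;> linarith
    · have h3 : (0 : ℝ) ≤ w.length := Nat.cast_nonneg _
      rw [SimpleGraph.Walk.length_cons, abs_le]
      push_cast
      constructor <;> linarith

/-- From a point of the edge `[a, b]` one reaches `a` by a path of length `1 - p.coord a`. -/
theorem exists_walk_of_edge (p : MetricGraph G) {a b : V} (hab : G.Adj a b)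
    (h : p.coord a + p.coord b = 1) :
    ∃ (c : V) (w : G.Walk c a), 0 < p.coord c ∧ (1 - p.coord c) + w.length = 1 - p.coord a := by
  rcases (p.nonneg a).eq_or_lt with ha | ha
  · refine ⟨b, hab.symm.toWalk, by linarith, ?_⟩
    simp only [SimpleGraph.Walk.length_cons, SimpleGraph.Walk.length_nil]
    push_cast
    linarith
  · exact ⟨a, SimpleGraph.Walk.nil, ha, by simp⟩

/-- A path inside an edge from `p` to `q`, followed by a path from `q` through the vertex `c`. -/
theorem exists_le_of_edge_of_walk {p q r : MetricGraph G} {u v c c' : V} (huv : G.Adj u v)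
    (hp : p.coord u + p.coord v = 1) (hq : q.coord u + q.coord v = 1) (w : G.Walk c c')
    (hc : 0 < q.coord c) (hc' : 0 < r.coord c') :
    ∃ L ∈ pathLengths p r,
      L ≤ |p.coord u - q.coord u| + ((1 - q.coord c) + w.length + (1 - r.coord c')) := by
  have hcuv : c = u ∨ c = v := by
    by_contra! h
    linarith [q.eq_zero_of_add_eq_one huv.ne h.1 h.2 hq]
  obtain ⟨a, b, hab, hpab, rfl, habs⟩ : ∃ a b, G.Adj a b ∧ p.coord a + p.coord b = 1 ∧ a = c ∧
      |p.coord a - q.coord a| = |p.coord u - q.coord u| := by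
    rcases hcuv with rfl | rfl
    · exact ⟨_, v, huv, hp, rfl, rfl⟩
    · refine ⟨_, u, huv.symm, by linarith, rfl, ?_⟩
      rw [show p.coord c - q.coord c = -(p.coord u - q.coord u) by linarith, abs_neg]
  obtain ⟨d, w', hd, hlen⟩ := p.exists_walk_of_edge hab hpab
  refine ⟨_, Or.inr ⟨d, c', w'.append w, hd, hc', rfl⟩, ?_⟩
  rw [SimpleGraph.Walk.length_append, ← habs]
  push_cast
  have := neg_abs_le (p.coord a - q.coord a)
  linarith

theorem exists_le_add {p q r : MetricGraph G} {L M : ℝ} (hL : L ∈ pathLengths p q)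
    (hM : M ∈ pathLengths q r) : ∃ N ∈ pathLengths p r, N ≤ L + M := by
  rcases hL with ⟨u, v, huv, hp, hq, rfl⟩ | ⟨u, u', w, hu, hu', rfl⟩
  · rcases hM with ⟨a, b, hab, hq', hr, rfl⟩ | ⟨a, a', w, ha, ha', rfl⟩
    · by_cases h1 : a = u ∧ b = v
      · obtain ⟨rfl, rfl⟩ := h1
        exact ⟨_, Or.inl ⟨a, b, huv, hp, hr, rfl⟩, abs_sub_le _ _ _⟩
      by_cases h2 : a = v ∧ b = u
      · obtain ⟨rfl, rfl⟩ := h2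
        refine ⟨_, Or.inl ⟨a, b, hab, by linarith, hr, rfl⟩, ?_⟩
        rw [show p.coord b - q.coord b = -(p.coord a - q.coord a) by linarith, abs_neg]
        exact abs_sub_le _ _ _
      obtain ⟨c, hc⟩ := q.exists_coord_pos
      have hcuv : c = u ∨ c = v := by
        by_contra! h
        linarith [q.eq_zero_of_add_eq_one huv.ne h.1 h.2 hq]
      have hcab : c = a ∨ c = b := by
        by_contra! h
        linarith [q.eq_zero_of_add_eq_one hab.ne h.1 h.2 hq']
      have hc1 : q.coord c = 1 := by
        rcases hcab with rfl | rfl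
        · have hb : q.coord b = 0 :=
            q.eq_zero_of_add_eq_one huv.ne (by have := hab.ne; grind) (by have := hab.ne; grind) hq
          linarith
        · have ha : q.coord a = 0 :=
            q.eq_zero_of_add_eq_one huv.ne (by have := hab.ne; grind) (by have := hab.ne; grind) hq
          linarith
      obtain ⟨e, w', he, hlen⟩ : ∃ (e : V) (w : G.Walk e c), 0 < r.coord e ∧
          (1 - r.coord e) + w.length = |q.coord a - r.coord a| := by
        rcases hcab with rfl | rfl
        · obtain ⟨e, w, he, h⟩ := r.exists_walk_of_edge hab hr
          refine ⟨e, w, he, ?_⟩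
          rw [hc1, abs_of_nonneg (by linarith [r.coord_le_one c])]
          exact h
        · obtain ⟨e, w, he, h⟩ := r.exists_walk_of_edge hab.symm (by linarith)
          refine ⟨e, w, he, ?_⟩
          rw [show q.coord a - r.coord a = -(1 - r.coord c) by linarith, abs_neg,
            abs_of_nonneg (by linarith [r.coord_le_one c])]
          exact h
      obtain ⟨N, hN, hle⟩ := exists_le_of_edge_of_walk huv hp hq w'.reverse hc he
      refine ⟨N, hN, hle.trans ?_⟩
      rw [SimpleGraph.Walk.length_reverse, ← hlen, hc1]
      linarith
    · exact exists_le_of_edge_of_walk huv hp hq w ha ha'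
  · rcases hM with ⟨a, b, hab, hq', hr, rfl⟩ | ⟨a, a', w', ha, ha', rfl⟩
    · obtain ⟨N, hN, hle⟩ := exists_le_of_edge_of_walk hab hr hq' w.reverse hu' hu
      refine ⟨N, pathLengths_symm hN, hle.trans ?_⟩
      rw [SimpleGraph.Walk.length_reverse, abs_sub_comm]
      linarith
    · by_cases h : u' = a
      · subst h
        refine ⟨_, Or.inr ⟨u, a', w.append w', hu, ha', rfl⟩, ?_⟩
        rw [SimpleGraph.Walk.length_append]
        push_cast
        linarith [q.coord_le_one u']
      · obtain ⟨hadj, hsum⟩ := q.add_eq_one_of_pos h hu' ha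
        refine ⟨_, Or.inr ⟨u, a', w.append (SimpleGraph.Walk.cons hadj w'), hu, ha', rfl⟩, ?_⟩
        rw [SimpleGraph.Walk.length_append, SimpleGraph.Walk.length_cons]
        push_cast
        linarith

/-- A connected graph, viewed as a metric graph, is a metric space. -/
noncomputable abbrev metricSpace (hG : G.Connected) : MetricSpace (MetricGraph G) where
  dist := dist
  dist_self p := le_antisymm (csInf_le (bddBelow_pathLengths p p) (zero_mem_pathLengths p))
    (Real.sInf_nonneg fun _ h => pathLengths_nonneg h)
  dist_comm p q := congrArg sInf
    (Set.Subset.antisymm (fun _ h => pathLengths_symm h) (fun _ h => pathLengths_symm h))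
  dist_triangle p q r := by
    refine le_of_forall_pos_le_add fun ε hε => ?_
    obtain ⟨L, hL, hL'⟩ := exists_lt_of_csInf_lt (pathLengths_nonempty hG p q)
      (show sInf (pathLengths p q) < dist p q + ε / 2 by rw [dist_def]; linarith)
    obtain ⟨M, hM, hM'⟩ := exists_lt_of_csInf_lt (pathLengths_nonempty hG q r)
      (show sInf (pathLengths q r) < dist q r + ε / 2 by rw [dist_def q r]; linarith)
    obtain ⟨N, hN, hle⟩ := exists_le_add hL hM
    have : dist p r ≤ N := csInf_le (bddBelow_pathLengths p r) hN
    linarith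
  eq_of_dist_eq_zero {p q} h := by
    ext c
    have : |p.coord c - q.coord c| ≤ dist p q :=
      le_csInf (pathLengths_nonempty hG p q) fun _ hL => abs_coord_sub_le hL c
    exact sub_eq_zero.1 (abs_eq_zero.1 (le_antisymm (this.trans h.le) (abs_nonneg _)))

end MetricGraph

/-- `S` is (the image of) a geodesic `γ : [a, b] → X` that joins `x` and `y`; a geodesic is a curve
with `d(γ(s), γ(t)) = |s - t|` for all `s, t ∈ [a, b]` (so that it is parametrized by arc
length). -/
def IsGeodesicSegment {X : Type*} [MetricSpace X] (x y : X) (S : Set X) : Prop :=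
  ∃ (a b : ℝ) (γ : ℝ → X), a ≤ b ∧ γ a = x ∧ γ b = y ∧
    (∀ s ∈ Set.Icc a b, ∀ t ∈ Set.Icc a b, dist (γ s) (γ t) = |s - t|) ∧
    S = γ '' Set.Icc a b

/-- A triangle with sides `A`, `B`, `C` is `δ`-thin if every point of a side is at distance at most
`δ` from the union of the other two sides. -/
def IsThinTriangle {X : Type*} [MetricSpace X] (δ : ℝ) (A B C : Set X) : Prop :=
  (∀ p ∈ A, Metric.infDist p (B ∪ C) ≤ δ) ∧
  (∀ p ∈ B, Metric.infDist p (C ∪ A) ≤ δ) ∧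
  (∀ p ∈ C, Metric.infDist p (A ∪ B) ≤ δ)

/-- `X` is Gromov hyperbolic: for some `δ ≥ 0`, every geodesic triangle in `X` is `δ`-thin. -/
def IsGromovHyperbolic (X : Type*) [MetricSpace X] : Prop :=
  ∃ δ : ℝ, 0 ≤ δ ∧ ∀ (x y z : X) (A B C : Set X),
    IsGeodesicSegment x y A → IsGeodesicSegment y z B → IsGeodesicSegment z x C →
    IsThinTriangle δ A B C

/-- A connected graph is hyperbolic if it is Gromov hyperbolic as a metric graph. -/
def SimpleGraph.IsHyperbolic {V : Type*} (G : SimpleGraph V) (hG : G.Connected) : Prop :=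
  letI := MetricGraph.metricSpace hG
  IsGromovHyperbolic (MetricGraph G)

/-! If `G₁` has an edge at every vertex, two points of the same fibre of the product are at most two
apart, whatever `G₂` is: step to a neighbouring fibre and back. Hence the projection to `G₁` and any
section `u ↦ (u, v₀)` change distances by at most 2 (`dist_fst_le_dist_lexProduct`,
`dist_lexProduct_le`).

It remains to see that hyperbolicity survives a bounded additive error
(`IsGromovHyperbolic.of_abs_dist_sub_le`). For such maps no stability theorem for quasi-geodesics is
needed: if `p` lies on a geodesic from `x` to `y`, then `f p` almost realizes the distance from `f
x` to `f y`, and thinness of the triangle `f x`, `f p`, `f y` forces `f p` to be near the geodesic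
(`exists_dist_le_of_thin`). Triangles are thus compared with triangles in the target. Rounding
points of a metric graph to vertices reduces everything to the combinatorial distance. -/

/-! ### Geodesic segments and thin triangles -/

namespace IsGeodesicSegment

variable {X : Type*} [MetricSpace X] {x y z : X} {S T : Set X}

theorem symm (h : IsGeodesicSegment x y S) : IsGeodesicSegment y x S := by
  obtain ⟨a, b, γ, hab, rfl, rfl, hγ, rfl⟩ := h
  refine ⟨-b, -a, fun t => γ (-t), by linarith, by simp, by simp, ?_, ?_⟩
  · intro s hs t ht
    rw [hγ _ ⟨by linarith [hs.2], by linarith [hs.1]⟩ _ ⟨by linarith [ht.2], by linarith [ht.1]⟩,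
      show -s - -t = -(s - t) by ring, abs_neg]
  · ext q
    constructor
    · rintro ⟨t, ht, rfl⟩
      exact ⟨-t, ⟨by linarith [ht.2], by linarith [ht.1]⟩, by simp⟩
    · rintro ⟨t, ht, rfl⟩
      exact ⟨-t, ⟨by linarith [ht.2], by linarith [ht.1]⟩, rfl⟩

theorem left_mem (h : IsGeodesicSegment x y S) : x ∈ S := by
  obtain ⟨a, b, γ, hab, rfl, rfl, hγ, rfl⟩ := h
  exact ⟨a, Set.left_mem_Icc.2 hab, rfl⟩

theorem right_mem (h : IsGeodesicSegment x y S) : y ∈ S := h.symm.left_mem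

theorem dist_add_dist (h : IsGeodesicSegment x y S) {q : X} (hq : q ∈ S) :
    dist x q + dist q y = dist x y := by
  obtain ⟨a, b, γ, hab, rfl, rfl, hγ, rfl⟩ := h
  obtain ⟨t, ht, rfl⟩ := hq
  have ha := Set.left_mem_Icc.2 hab
  have hb := Set.right_mem_Icc.2 hab
  rw [hγ a ha t ht, hγ t ht b hb, hγ a ha b hb, abs_of_nonpos (by linarith [ht.1]),
    abs_of_nonpos (by linarith [ht.2]), abs_of_nonpos (by linarith)]
  ring

theorem dist_eq_abs (h : IsGeodesicSegment x y S) {q r : X} (hq : q ∈ S) (hr : r ∈ S) :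
    dist q r = |dist x q - dist x r| := by
  obtain ⟨a, b, γ, hab, rfl, rfl, hγ, rfl⟩ := h
  obtain ⟨s, hs, rfl⟩ := hq
  obtain ⟨t, ht, rfl⟩ := hr
  have ha := Set.left_mem_Icc.2 hab
  rw [hγ s hs t ht, hγ a ha s hs, hγ a ha t ht, abs_of_nonpos (a := a - s) (by linarith [hs.1]),
    abs_of_nonpos (a := a - t) (by linarith [ht.1])]
  congr 1
  ring

theorem exists_dist_eq (h : IsGeodesicSegment x y S) {t : ℝ} (h0 : 0 ≤ t) (ht : t ≤ dist x y) :
    ∃ q ∈ S, dist x q = t := by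
  obtain ⟨a, b, γ, hab, rfl, rfl, hγ, rfl⟩ := h
  have ha := Set.left_mem_Icc.2 hab
  rw [hγ a ha b (Set.right_mem_Icc.2 hab), abs_of_nonpos (by linarith)] at ht
  have hm : a + t ∈ Set.Icc a b := ⟨by linarith, by linarith⟩
  refine ⟨_, ⟨a + t, hm, rfl⟩, ?_⟩
  rw [hγ a ha _ hm, abs_of_nonpos (by linarith)]
  ring

theorem refl (x : X) : IsGeodesicSegment x x {x} :=
  ⟨0, 0, fun _ => x, le_rfl, rfl, rfl, by
    intro s hs t ht
    rw [Set.Icc_self, Set.mem_singleton_iff] at hs ht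
    simp [hs, ht], by simp⟩

/-- Two geodesic segments whose lengths add up to the distance of the endpoints concatenate. -/
theorem exists_trans (hS : IsGeodesicSegment x y S) (hT : IsGeodesicSegment y z T)
    (h : dist x y + dist y z = dist x z) : ∃ U, IsGeodesicSegment x z U := by
  obtain ⟨a, b, γ, hab, rfl, rfl, hγ, rfl⟩ := hS
  obtain ⟨c, d, η, hcd, hy, rfl, hη, rfl⟩ := hT
  have ha := Set.left_mem_Icc.2 hab
  have hb := Set.right_mem_Icc.2 hab
  have hc := Set.left_mem_Icc.2 hcd
  have hd := Set.right_mem_Icc.2 hcd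
  let ξ : ℝ → X := fun t => if t ≤ b then γ t else η (t - b + c)
  have hle : ∀ t, t ≤ b → ξ t = γ t := fun t ht => if_pos ht
  have hge : ∀ t, b ≤ t → ξ t = η (t - b + c) := by
    intro t ht
    rcases ht.eq_or_lt with rfl | ht
    · rw [hle _ le_rfl, sub_self, zero_add, hy]
    · exact if_neg ht.not_ge
  have key : ∀ s t, a ≤ s → s ≤ t → t ≤ b + d - c → dist (ξ s) (ξ t) = |s - t| := by
    intro s t hs hst ht
    rcases le_total t b with htb | htb
    · rw [hle s (hst.trans htb), hle t htb, hγ s ⟨hs, hst.trans htb⟩ t ⟨hs.trans hst, htb⟩]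
    rcases le_total b s with hsb | hsb
    · rw [hge s hsb, hge t htb, hη _ ⟨by linarith, by linarith⟩ _ ⟨by linarith, by linarith⟩]
      congr 1
      ring
    · have ht' : t - b + c ∈ Set.Icc c d := ⟨by linarith, by linarith⟩
      have hs' : s ∈ Set.Icc a b := ⟨hs, hsb⟩
      rw [hle s hsb, hge t htb, abs_of_nonpos (by linarith)]
      have e1 := hγ a ha s hs'
      have e2 := hγ s hs' b hb
      have e3 := hη c hc _ ht'
      have e4 := hη _ ht' d hd
      have e5 := hγ a ha b hb
      have e6 := hη c hc d hd
      rw [abs_of_nonpos (by linarith)] at e1 e2 e5 e6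
      rw [abs_of_nonpos (by linarith)] at e3
      rw [abs_of_nonpos (by linarith [ht'.2])] at e4
      rw [hy] at e3 e6
      -- The first inequality bounds the distance from above. The second bounds it from below: a
      -- shortcut would bring the endpoints closer than the sum of the two lengths, against `h`.
      have t1 := dist_triangle (γ s) (γ b) (η (t - b + c))
      have t2 := dist_triangle4 (γ a) (γ s) (η (t - b + c)) (η d)
      linarith
  refine ⟨_, a, b + d - c, ξ, by linarith, hle a hab, ?_, ?_, rfl⟩
  · rw [hge _ (by linarith)]
    congr 1
    ring
  · intro s hs t ht
    rcases le_total s t with hst | hst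
    · exact key s t hs.1 hst ht.2
    · rw [dist_comm, abs_sub_comm]
      exact key t s ht.1 hst hs.2

/-- A point that almost realizes the distance between `x` and `y` is close to any geodesic from `x`
to `y`, if the triangle spanned by the three points is thin. -/
theorem exists_dist_le_of_thin {p : X} {A B : Set X} {δ C : ℝ} (hS : IsGeodesicSegment x y S)
    (hA : IsGeodesicSegment x p A) (hB : IsGeodesicSegment p y B)
    (hthin : IsThinTriangle δ A B S) (hp : dist x p + dist p y ≤ dist x y + C) :
    ∃ m ∈ S, dist p m ≤ C / 2 + 2 * (δ + 1) := by
  have hA0 : A.Nonempty := ⟨x, hA.left_mem⟩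
  have hB0 : B.Nonempty := ⟨p, hB.left_mem⟩
  -- Along the side opposite `p`, the distance to `A` minus the distance to `B` changes sign, so
  -- some `m` is equally far from both; thinness then makes it close to both. The extra 1 is slack,
  -- since an infimum distance need not be attained.
  obtain ⟨m, hm, hmA, hmB⟩ : ∃ m ∈ S, Metric.infDist m A < δ + 1 ∧ Metric.infDist m B < δ + 1 := by
    have hthinS := hthin.2.2
    obtain ⟨a, b, γ, hab, rfl, rfl, hγ, rfl⟩ := hS
    have hγc : ContinuousOn γ (Set.Icc a b) := by
      refine (LipschitzOnWith.of_dist_le_mul (K := 1) fun s hs t ht => ?_).continuousOn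
      rw [hγ s hs t ht, Real.dist_eq]
      simp
    have hc : ContinuousOn (fun t => Metric.infDist (γ t) A - Metric.infDist (γ t) B)
        (Set.Icc a b) :=
      ((Metric.continuous_infDist_pt A).comp_continuousOn hγc).sub
        ((Metric.continuous_infDist_pt B).comp_continuousOn hγc)
    have h0 : (0 : ℝ) ∈ Set.Icc (Metric.infDist (γ a) A - Metric.infDist (γ a) B)
        (Metric.infDist (γ b) A - Metric.infDist (γ b) B) := by
      rw [Metric.infDist_zero_of_mem hA.left_mem, Metric.infDist_zero_of_mem hB.right_mem]
      exact ⟨by linarith [Metric.infDist_nonneg (x := γ a) (s := B)],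
        by linarith [Metric.infDist_nonneg (x := γ b) (s := A)]⟩
    obtain ⟨t, ht, h⟩ := intermediate_value_Icc hab hc h0
    have h : Metric.infDist (γ t) A - Metric.infDist (γ t) B = 0 := h
    have hlt : Metric.infDist (γ t) (A ∪ B) < δ + 1 := by
      linarith [hthinS _ (Set.mem_image_of_mem γ ht)]
    obtain ⟨r, hr, hrd⟩ := (Metric.infDist_lt_iff (hA0.mono Set.subset_union_left)).1 hlt
    refine ⟨γ t, Set.mem_image_of_mem γ ht, ?_⟩
    rcases hr with hr | hr <;> have := Metric.infDist_le_dist_of_mem (x := γ t) hr <;>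
      constructor <;> linarith
  obtain ⟨u, hu, hmu⟩ := (Metric.infDist_lt_iff hA0).1 hmA
  obtain ⟨v, hv, hmv⟩ := (Metric.infDist_lt_iff hB0).1 hmB
  refine ⟨m, hm, ?_⟩
  -- Replacing the detour through `p` by one through `m` gives `d(u, p) + d(p, v) ≤ C + 2(δ + 1)`;
  -- averaging the routes from `p` to `m` through `u` and through `v` gives the bound.
  have e1 := hA.dist_add_dist hu
  have e2 := hB.dist_add_dist hv
  have t1 := dist_triangle4 x u m y
  have t2 := dist_triangle m v y
  have t3 := dist_triangle p u m
  have t4 := dist_triangle p v m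
  rw [dist_comm] at hmu
  rw [dist_comm p u] at t3
  rw [dist_comm v m] at t4
  linarith

end IsGeodesicSegment

/-! ### Hyperbolicity under bounded additive distortion -/

/-- Hyperbolicity of `Y` passes to `X` along a map that distorts distances by a bounded amount,
provided that points of its range are joined by geodesics. -/
theorem IsGromovHyperbolic.of_abs_dist_sub_le {X Y : Type*} [MetricSpace X] [MetricSpace Y]
    (hY : IsGromovHyperbolic Y) (f : X → Y) (K : ℝ) (hf : ∀ a b, |dist (f a) (f b) - dist a b| ≤ K)
    (hgeod : ∀ a b, ∃ S, IsGeodesicSegment (f a) (f b) S) : IsGromovHyperbolic X := by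
  obtain ⟨δ, hδ, hthin⟩ := hY
  have hf₁ : ∀ a b, dist (f a) (f b) ≤ dist a b + K := fun a b => by
    linarith [(abs_le.1 (hf a b)).2]
  have hf₂ : ∀ a b, dist a b ≤ dist (f a) (f b) + K := fun a b => by
    linarith [(abs_le.1 (hf a b)).1]
  obtain hX | hX := isEmpty_or_nonempty X
  · exact ⟨0, le_rfl, fun x => isEmptyElim x⟩
  obtain ⟨x₀⟩ := hX
  have hK : 0 ≤ K := (abs_nonneg _).trans (hf x₀ x₀)
  -- The image of a point on a geodesic exceeds the distance of the image endpoints by at most `3 *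
  -- K`: one `K` for each of the three distances involved.
  set D : ℝ := 3 * K / 2 + 2 * (δ + 1) with hD
  have near : ∀ {x y p : X} {T : Set X} {S : Set Y}, IsGeodesicSegment x y T →
      IsGeodesicSegment (f x) (f y) S → p ∈ T → ∃ m ∈ S, dist (f p) m ≤ D := by
    intro x y p T S hT hS hp
    obtain ⟨A, hA⟩ := hgeod x p
    obtain ⟨B, hB⟩ := hgeod p y
    refine hS.exists_dist_le_of_thin hA hB (hthin _ _ _ _ _ _ hA hB hS.symm) ?_
    linarith [hT.dist_add_dist hp, hf₁ x p, hf₁ p y, hf₂ x y]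
  have lift : ∀ {x y : X} {T : Set X} {S : Set Y} {m : Y}, IsGeodesicSegment x y T →
      IsGeodesicSegment (f x) (f y) S → m ∈ S → ∃ q ∈ T, dist (f q) m ≤ 2 * D + 2 * K := by
    intro x y T S m hT hS hm
    have hmS := hS.dist_add_dist hm
    -- Choose `q` as far from `x` as `m` is from `f x`, truncated to the length of `T`. The point
    -- `m'` of `S` near `f q` then has almost the same position on `S` as `m`.
    obtain ⟨q, hq, hxq⟩ := hT.exists_dist_eq (t := min (dist (f x) m) (dist x y))
      (le_min dist_nonneg dist_nonneg) (min_le_right _ _)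
    obtain ⟨m', hm', hqm'⟩ := near hT hS hq
    refine ⟨q, hq, ?_⟩
    have h1 : dist (f x) m ≤ dist x q + K := by
      rw [hxq, ← min_add_add_right]
      refine le_min (by linarith) ?_
      linarith [hf₁ x y, dist_nonneg (x := m) (y := f y)]
    have h2 : dist x q ≤ dist (f x) m := hxq.trans_le (min_le_left _ _)
    have h3 := dist_triangle (f x) (f q) m'
    have h4 := dist_triangle (f x) m' (f q)
    have h5 : dist m' m ≤ D + 2 * K := by
      rw [hS.dist_eq_abs hm' hm, abs_le]
      rw [dist_comm m'] at h4
      constructor <;> linarith [hf₁ x q, hf₂ x q]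
    linarith [dist_triangle (f q) m' m]
  have key : ∀ {x y z : X} {A B C : Set X}, IsGeodesicSegment x y A → IsGeodesicSegment y z B →
      IsGeodesicSegment z x C → ∀ p ∈ A,
        Metric.infDist p (B ∪ C) ≤ D + (δ + 1) + (2 * D + 2 * K) + K := by
    intro x y z A B C hA hB hC p hp
    obtain ⟨A', hA'⟩ := hgeod x y
    obtain ⟨B', hB'⟩ := hgeod y z
    obtain ⟨C', hC'⟩ := hgeod z x
    obtain ⟨m, hm, hpm⟩ := near hA hA' hp
    have hlt : Metric.infDist m (B' ∪ C') < δ + 1 := by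
      linarith [(hthin _ _ _ _ _ _ hA' hB' hC').1 m hm]
    have hne : (B' ∪ C').Nonempty := ⟨_, Or.inl hB'.left_mem⟩
    obtain ⟨r, hr, hmr⟩ := (Metric.infDist_lt_iff hne).1 hlt
    obtain ⟨q, hq, hqr⟩ : ∃ q ∈ B ∪ C, dist (f q) r ≤ 2 * D + 2 * K := by
      rcases hr with hr | hr
      · obtain ⟨q, hq, h⟩ := lift hB hB' hr
        exact ⟨q, Or.inl hq, h⟩
      · obtain ⟨q, hq, h⟩ := lift hC hC' hr
        exact ⟨q, Or.inr hq, h⟩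
    -- The constant adds up along `f p`, `m`, `r`, `f q`; the last `K` is the cost of returning to
    -- `X`.
    refine (Metric.infDist_le_dist_of_mem hq).trans ?_
    have h1 := dist_triangle4 (f p) m r (f q)
    rw [dist_comm r] at h1
    linarith [hf₂ p q]
  refine ⟨D + (δ + 1) + (2 * D + 2 * K) + K, by positivity, ?_⟩
  intro x y z A B C hA hB hC
  exact ⟨key hA hB hC, key hB hC hA, key hC hA hB⟩

/-! ### Vertices, edges and geodesics of the metric graph -/

namespace MetricGraph

variable {V : Type*} {G : SimpleGraph V}

open Classical in
/-- A vertex as a point of the metric graph. -/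
noncomputable def vertex (G : SimpleGraph V) (u : V) : MetricGraph G where
  coord w := if w = u then 1 else 0
  nonneg w := by split_ifs <;> norm_num
  mem_vertex_or_edge := Or.inl ⟨u, by simp, fun w hw => by simp [hw]⟩

@[simp] theorem vertex_coord_self (u : V) : (vertex G u).coord u = 1 := by simp [vertex]

theorem vertex_coord_of_ne {u w : V} (h : w ≠ u) : (vertex G u).coord w = 0 := by simp [vertex, h]

theorem eq_of_vertex_coord_pos {u w : V} (h : 0 < (vertex G u).coord w) : w = u := by
  by_contra hne
  exact h.ne' (vertex_coord_of_ne hne)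

open Classical in
/-- The point at distance `t` from `u` on the edge `[u, v]`. -/
noncomputable def edgePoint {u v : V} (h : G.Adj u v) (t : Set.Icc (0 : ℝ) 1) : MetricGraph G where
  coord w := if w = u then 1 - t else if w = v then t else 0
  nonneg w := by
    have h0 := t.2.1
    have h1 := t.2.2
    split_ifs <;> linarith
  mem_vertex_or_edge := Or.inr ⟨u, v, h, by simp [h.ne'], fun w hu hv => by simp [hu, hv]⟩

@[simp] theorem edgePoint_coord_left {u v : V} (h : G.Adj u v) (t : Set.Icc (0 : ℝ) 1) :
    (edgePoint h t).coord u = 1 - t := by simp [edgePoint]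

@[simp] theorem edgePoint_coord_right {u v : V} (h : G.Adj u v) (t : Set.Icc (0 : ℝ) 1) :
    (edgePoint h t).coord v = t := by simp [edgePoint, h.ne']

theorem edgePoint_zero {u v : V} (h : G.Adj u v) :
    edgePoint h ⟨0, by simp⟩ = vertex G u := by
  ext w
  simp [edgePoint, vertex]

theorem edgePoint_one {u v : V} (h : G.Adj u v) :
    edgePoint h ⟨1, by simp⟩ = vertex G v := by
  ext w
  by_cases hw : w = u
  · subst hw
    simp [edgePoint, vertex, h.ne]
  · simp [edgePoint, vertex, hw]

/-- The path inside the edge gives the upper bound; the lower bound holds because each barycentric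
coordinate is 1-Lipschitz. -/
theorem dist_edgePoint (hG : G.Connected) {u v : V} (h : G.Adj u v) (s t : Set.Icc (0 : ℝ) 1) :
    dist (edgePoint h s) (edgePoint h t) = |(s : ℝ) - t| := by
  refine le_antisymm (csInf_le (bddBelow_pathLengths _ _) (Or.inl ⟨u, v, h, by simp, by simp, ?_⟩))
    (le_csInf (pathLengths_nonempty hG _ _) fun L hL => ?_)
  · rw [edgePoint_coord_left, edgePoint_coord_left, abs_sub_comm]
    congr 1
    ring
  · simpa using abs_coord_sub_le hL v

theorem dist_vertex_le_one (p : MetricGraph G) {u : V} (hu : 0 < p.coord u) :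
    dist p (vertex G u) ≤ 1 :=
  csInf_le_of_le (bddBelow_pathLengths _ _)
    (Or.inr ⟨u, u, SimpleGraph.Walk.nil, hu, by simp, rfl⟩) (by simp [hu.le])

theorem dist_vertex_vertex (hG : G.Connected) (u v : V) :
    dist (vertex G u) (vertex G v) = G.dist u v := by
  refine le_antisymm ?_ (le_csInf (pathLengths_nonempty hG _ _) fun L hL => ?_)
  · obtain ⟨w, hw⟩ := hG.exists_walk_length_eq_dist u v
    exact csInf_le (bddBelow_pathLengths _ _)
      (Or.inr ⟨u, v, w, by simp, by simp, by simp [hw]⟩)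
  · rcases hL with ⟨a, b, hab, hu, hv, rfl⟩ | ⟨a, b, w, ha, hb, rfl⟩
    -- A path inside one edge that joins distinct vertices joins the two ends of that edge, so it
    -- has length one.
    · by_cases huv : u = v
      · simp [huv]
      have hua : u = a ∨ u = b := by
        by_contra! hne
        rw [vertex_coord_of_ne hne.1.symm, vertex_coord_of_ne hne.2.symm] at hu
        norm_num at hu
      have hva : v = a ∨ v = b := by
        by_contra! hne
        rw [vertex_coord_of_ne hne.1.symm, vertex_coord_of_ne hne.2.symm] at hv
        norm_num at hv
      rcases hua with rfl | rfl <;> rcases hva with rfl | rfl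
      · exact absurd rfl huv
      · simp [vertex_coord_of_ne huv, SimpleGraph.dist_eq_one_iff_adj.2 hab]
      · simp [vertex_coord_of_ne hab.ne, SimpleGraph.dist_eq_one_iff_adj.2 hab.symm]
      · exact absurd rfl huv
    · obtain rfl := eq_of_vertex_coord_pos ha
      obtain rfl := eq_of_vertex_coord_pos hb
      simpa using SimpleGraph.dist_le w

/-- The edge between two adjacent vertices is a geodesic segment. -/
theorem exists_isGeodesicSegment_of_adj (hG : G.Connected) {u v : V} (h : G.Adj u v) :
    letI := metricSpace hG
    ∃ S, IsGeodesicSegment (vertex G u) (vertex G v) S := by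
  let := metricSpace hG
  -- Curves are functions on all of `ℝ`, so the parameter is clamped to the unit interval.
  refine ⟨_, 0, 1, fun t => edgePoint h (Set.projIcc 0 1 zero_le_one t), zero_le_one, ?_, ?_, ?_,
    rfl⟩
  · exact (congrArg (edgePoint h) (Set.projIcc_left zero_le_one)).trans (edgePoint_zero h)
  · exact (congrArg (edgePoint h) (Set.projIcc_right zero_le_one)).trans (edgePoint_one h)
  · intro s hs t ht
    refine (dist_edgePoint hG h _ _).trans ?_
    rw [Set.projIcc_of_mem _ hs, Set.projIcc_of_mem _ ht]

/-- The tail of a shortest walk is shortest, so its edges concatenate one by one into a geodesic.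
Geodesics between vertices suffice, since the comparison maps take only vertices as values. -/
theorem exists_isGeodesicSegment (hG : G.Connected) (u v : V) :
    letI := metricSpace hG
    ∃ S, IsGeodesicSegment (vertex G u) (vertex G v) S := by
  let := metricSpace hG
  have hdist : ∀ a b, dist (vertex G a) (vertex G b) = G.dist a b := dist_vertex_vertex hG
  have key : ∀ {u v : V} (w : G.Walk u v), w.length = G.dist u v →
      ∃ S, IsGeodesicSegment (vertex G u) (vertex G v) S := by
    intro u v w
    induction w with
    | nil => exact fun _ => ⟨_, IsGeodesicSegment.refl _⟩
    | @cons a b c h p ih =>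
      intro hlen
      rw [SimpleGraph.Walk.length_cons] at hlen
      have h1 : G.dist a b = 1 := SimpleGraph.dist_eq_one_iff_adj.2 h
      have h2 := hG.dist_triangle (u := a) (v := b) (w := c)
      have h3 := SimpleGraph.dist_le p
      obtain ⟨T, hT⟩ := ih (by omega)
      obtain ⟨S, hS⟩ := exists_isGeodesicSegment_of_adj hG h
      refine hS.exists_trans hT ?_
      rw [hdist, hdist, hdist, ← Nat.cast_add]
      congr 1
      omega
  obtain ⟨w, hw⟩ := hG.exists_walk_length_eq_dist u v
  exact key w hw

end MetricGraph

/-! ### From combinatorial distance to hyperbolicity -/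

namespace SimpleGraph

/-- Hyperbolicity of `H` passes to `G` along a map of vertices that distorts distances by a bounded
amount. -/
theorem IsHyperbolic.of_dist_le {V W : Type*} {G : SimpleGraph V} {H : SimpleGraph W}
    {hG : G.Connected} {hH : H.Connected} (h : H.IsHyperbolic hH) (φ : V → W) (K : ℕ)
    (h₁ : ∀ a b, H.dist (φ a) (φ b) ≤ G.dist a b + K)
    (h₂ : ∀ a b, G.dist a b ≤ H.dist (φ a) (φ b) + K) : G.IsHyperbolic hG := by
  let := MetricGraph.metricSpace hG
  let := MetricGraph.metricSpace hH
  choose c hc using fun p : MetricGraph G => p.exists_coord_pos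
  have hcd : ∀ p, Dist.dist p (MetricGraph.vertex G (c p)) ≤ 1 := fun p =>
    MetricGraph.dist_vertex_le_one p (hc p)
  have hdG : ∀ a b, Dist.dist (MetricGraph.vertex G a) (MetricGraph.vertex G b) = G.dist a b :=
    MetricGraph.dist_vertex_vertex hG
  have hdH : ∀ a b, Dist.dist (MetricGraph.vertex H a) (MetricGraph.vertex H b) = H.dist a b :=
    MetricGraph.dist_vertex_vertex hH
  -- Rounding each of the two points to a vertex costs at most 1, hence `K + 2`.
  refine IsGromovHyperbolic.of_abs_dist_sub_le (Y := MetricGraph H) h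
    (fun p => MetricGraph.vertex H (φ (c p))) (K + 2) (fun p q => ?_)
    fun p q => MetricGraph.exists_isGeodesicSegment hH _ _
  have e1 : (H.dist (φ (c p)) (φ (c q)) : ℝ) ≤ G.dist (c p) (c q) + K := by exact_mod_cast h₁ _ _
  have e2 : (G.dist (c p) (c q) : ℝ) ≤ H.dist (φ (c p)) (φ (c q)) + K := by exact_mod_cast h₂ _ _
  have t1 := dist_triangle4 p (MetricGraph.vertex G (c p)) (MetricGraph.vertex G (c q)) q
  have t2 := dist_triangle4 (MetricGraph.vertex G (c p)) p q (MetricGraph.vertex G (c q))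
  rw [_root_.dist_comm (MetricGraph.vertex G (c q)) q] at t1
  rw [_root_.dist_comm _ p] at t2
  rw [hdG] at t1 t2
  rw [hdH, abs_le]
  constructor <;> linarith [hcd p, hcd q]

theorem Connected.dist_map_le {V W : Type*} {G : SimpleGraph V} {H : SimpleGraph W}
    (hG : G.Connected) (f : G →g H) (a b : V) : H.dist (f a) (f b) ≤ G.dist a b := by
  obtain ⟨w, hw⟩ := hG.exists_walk_length_eq_dist a b
  rw [← hw, ← w.length_map f]
  exact dist_le _

/-! ### Distances in the lexicographic product -/

section LexProduct

variable {V₁ V₂ : Type*} {G₁ : SimpleGraph V₁} {G₂ : SimpleGraph V₂}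

/-- The copy of the first factor in a lexicographic product that sits over `v`. -/
def lexProductLeft (G₁ : SimpleGraph V₁) (G₂ : SimpleGraph V₂) (v : V₂) :
    G₁ →g G₁.lexProduct G₂ :=
  ⟨fun u => (u, v), fun h => Or.inl h⟩

/-- The projection of a lexicographic product to its first factor does not increase distances. -/
theorem dist_fst_le_dist_lexProduct (h₁ : G₁.Connected) (h₂ : G₂.Connected) (x y : V₁ × V₂) :
    G₁.dist x.1 y.1 ≤ (G₁.lexProduct G₂).dist x y := by
  obtain ⟨w, hw⟩ := (h₁.lexProduct h₂).exists_walk_length_eq_dist x y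
  rw [← hw]
  clear hw
  induction w with
  | nil => simp
  | @cons a b c h p ih =>
    have h3 := h₁.dist_triangle (u := a.1) (v := b.1) (w := c.1)
    -- An edge of the product projects to an edge, or to a single vertex if it lies in a fibre.
    have h4 : G₁.dist a.1 b.1 ≤ 1 := by
      rcases h with h | h
      · exact (dist_eq_one_iff_adj.2 h).le
      · simp [h.1]
    rw [Walk.length_cons]
    omega

/-- Two steps, through a neighbouring fibre, correct the second coordinate without using `G₂`; the
rest of the way runs in the copy of `G₁` over `y.2`. Nontriviality supplies the neighbour. -/
theorem dist_lexProduct_le [Nontrivial V₁] (h₁ : G₁.Connected) (h₂ : G₂.Connected)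
    (x y : V₁ × V₂) : (G₁.lexProduct G₂).dist x y ≤ G₁.dist x.1 y.1 + 2 := by
  obtain ⟨u', hu⟩ := h₁.preconnected.exists_adj_of_nontrivial x.1
  have a1 : (G₁.lexProduct G₂).Adj x (u', y.2) := Or.inl hu
  have a2 : (G₁.lexProduct G₂).Adj (u', y.2) (x.1, y.2) := Or.inl hu.symm
  have e1 := dist_le (Walk.cons a1 (Walk.cons a2 Walk.nil))
  have e2 : (G₁.lexProduct G₂).dist (x.1, y.2) y ≤ G₁.dist x.1 y.1 :=
    h₁.dist_map_le (lexProductLeft G₁ G₂ y.2) x.1 y.1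
  have e3 := (h₁.lexProduct h₂).dist_triangle (u := x) (v := (x.1, y.2)) (w := y)
  simp only [Walk.length_cons, Walk.length_nil] at e1
  omega

/-- The lexicographic product of a one-vertex graph with `G₂` is isomorphic to `G₂`. -/
def lexProductUniqueIso [Unique V₁] (G₁ : SimpleGraph V₁) (G₂ : SimpleGraph V₂) :
    G₁.lexProduct G₂ ≃g G₂ where
  toEquiv := Equiv.uniqueProd V₂ V₁
  map_rel_iff' {x y} := by
    have h : x.1 = y.1 := Subsingleton.elim _ _
    simp [lexProduct, h]

/-- Hyperbolicity is invariant under graph isomorphism. -/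
theorem IsHyperbolic.iff_of_iso {V W : Type*} {G : SimpleGraph V} {H : SimpleGraph W}
    {hG : G.Connected} {hH : H.Connected} (e : G ≃g H) :
    G.IsHyperbolic hG ↔ H.IsHyperbolic hH := by
  have h₁ : ∀ a b, H.dist (e a) (e b) ≤ G.dist a b := hG.dist_map_le e.toHom
  have h₂ : ∀ a b, G.dist (e.symm a) (e.symm b) ≤ H.dist a b := hH.dist_map_le e.symm.toHom
  exact ⟨fun h => h.of_dist_le e.symm 0 h₂ fun a b => by simpa using h₁ (e.symm a) (e.symm b),
    fun h => h.of_dist_le e 0 h₁ fun a b => by simpa using h₂ (e a) (e b)⟩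

end LexProduct

end SimpleGraph

theorem theoremt {V₁ V₂ : Type*} (G₁ : SimpleGraph V₁) (G₂ : SimpleGraph V₂)
    (h₁ : G₁.Connected) (h₂ : G₂.Connected) :
    (Nontrivial V₁ →
      ((G₁.lexProduct G₂).IsHyperbolic (h₁.lexProduct h₂) ↔ G₁.IsHyperbolic h₁)) ∧
    (Subsingleton V₁ →
      Nonempty (G₁.lexProduct G₂ ≃g G₂) ∧
      ((G₁.lexProduct G₂).IsHyperbolic (h₁.lexProduct h₂) ↔ G₂.IsHyperbolic h₂)) := by
  constructor
  · intro _
    obtain ⟨v₀⟩ := h₂.nonempty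
    have hle := SimpleGraph.dist_fst_le_dist_lexProduct h₁ h₂
    have hge := SimpleGraph.dist_lexProduct_le h₁ h₂
    -- Hyperbolicity is pulled back to `G₁` along the section over `v₀`, and to the product along
    -- the projection.
    exact ⟨fun h => h.of_dist_le (fun u => (u, v₀)) 2 (fun a b => hge (a, v₀) (b, v₀))
        fun a b => (hle (a, v₀) (b, v₀)).trans (Nat.le_add_right _ _),
      fun h => h.of_dist_le Prod.fst 2 (fun a b => (hle a b).trans (Nat.le_add_right _ _)) hge⟩
  · intro _
    obtain ⟨u₀⟩ := h₁.nonempty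
    let := uniqueOfSubsingleton u₀
    have e := SimpleGraph.lexProductUniqueIso G₁ G₂
    exact ⟨⟨e⟩, SimpleGraph.IsHyperbolic.iff_of_iso e⟩
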